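/- For $f\in L^2(\mathbb R)$ (complex-valued) the spectrum of $f$ is the closed support of its Plancherel Fourier transform $\hat f(x)=\int_{\mathbb R} f(t)e^{-itx}\,dt$, that is, the complement of the union of all open sets on which $\hat f=0$ almost everywhere. A bounded non-negative function $\omega$ on $\mathbb R$ is called a Beurling--Malliavin majorant if for every $\sigma>0$ there is a non-zero $f\in L^2(\mathbb R)$ with $|f|\le\omega$ a.e. and with spectrum contained in $[-\sigma,\sigma]$. Theorem. Let $H:\mathbb R\to(0,\infty)$ be increasing (not necessarily strictly) and unbounded on $[0,\infty)$. Then there exists a non-negative $\Omega\in C^1(\mathbb R)$ such that (i) $|\Omega'(t)|\le H(t)$ for all $t\in\mathbb R$; (ii) $\displaystyle\int_{\mathbb R}\frac{\Omega(t)}{1+t^2}\,dt<\infty$; (iii) every $f\in L^2(\mathbb R)$ with bounded spectrum and with $|f|\le e^{-\Omega}$ almost everywhere vanishes almost everywhere. In particular, $e^{-\Omega}$ is not a Beurling--Malliavin majorant. -/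

import Mathlib

open MeasureTheory FourierTransform

noncomputable section

/-- The closed (essential) support of a function on the real line: the complement of the union of
all open sets on which the function vanishes almost everywhere. -/
def essSupport (g : ℝ → ℂ) : Set ℝ :=
  (⋃₀ {O : Set ℝ | IsOpen O ∧ ∀ᵐ x ∂(volume.restrict O), g x = 0})ᶜ

/-- The Fourier transform of an `L²`-function in the sense of Plancherel, in the normalisation
`f̂(x) = ∫ f(t) e^{-itx} dt`. Mathlib's transform `𝓕` uses the kernel `e^{-2πitx}`, hence the
rescaling of the variable. -/
def planchFourier (f : Lp ℂ 2 (volume : Measure ℝ)) : ℝ → ℂ :=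
  fun x => (𝓕 f : Lp ℂ 2 (volume : Measure ℝ)) (x / (2 * Real.pi))

/-- The spectrum of an `L²`-function: the closed support of its Fourier transform. -/
def spec (f : Lp ℂ 2 (volume : Measure ℝ)) : Set ℝ := essSupport (planchFourier f)

/-- Beurling--Malliavin majorants: bounded non-negative functions `ω` such that, for every `σ > 0`,
some non-zero `L²`-function `f` satisfies `|f| ≤ ω` a.e. and has its spectrum in `[-σ, σ]`. -/
def IsBMMajorant (ω : ℝ → ℝ) : Prop :=
  (∀ x, 0 ≤ ω x) ∧ (∃ C : ℝ, ∀ x, ω x ≤ C) ∧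
    ∀ σ : ℝ, 0 < σ → ∃ f : Lp ℂ 2 (volume : Measure ℝ), f ≠ 0 ∧
      (∀ᵐ x : ℝ, ‖f x‖ ≤ ω x) ∧ spec f ⊆ Set.Icc (-σ) σ

end

/-!
The weight `Ω` is a sum of sparse bumps on the positive half-line: around a point `m k`, on an
interval of relative radius `δ k = 2 ^ (-k - 2)`, it is at least `k ^ 2 * m k`. The slope of the
bump is of order `k ^ 2 / δ k`, which `H` allows once `m k` is far enough out, and its contribution
to the logarithmic integral is of order `k ^ 2 * δ k`, which is summable (`exists_weight`).

Let `f` have bounded spectrum and satisfy `|f| ≤ exp (-Ω)`. By Fourier inversion `f` agrees almost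
everywhere with the Fourier integral of an integrable function of compact support, which is close to
its Taylor polynomials: around the centre `m`, those of degree about `60 s m` are exponentially
precise on `[-m, m]`, where `s` bounds the spectrum (`hasTaylorApprox_fourierInv`). A polynomial of
degree below `n` which is small on an interval of relative length `δ` grows at most by a factor
`(C / δ) ^ n` at comparable distances (`norm_eval_le_of_norm_le_on_interval`). With `n = 60 s m k`
and `δ = δ k` this loss is only `exp (O (k * m k))`, whereas `f` is as small as
`exp (-k ^ 2 * m k)` on the interval around `m k`. The resulting bound for `f` on `[-m k, m k]`
tends to zero as `k → ∞`, so `f` vanishes (`HasTaylorApprox.eq_zero`).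
-/

open MeasureTheory FourierTransform

noncomputable section

/-! ### Growth of polynomials and of functions with good Taylor approximation -/

lemma prod_erase_range_abs_sub (N j : ℕ) (hj : j ≤ N) :
    ∏ i ∈ (Finset.range (N + 1)).erase j, |(j : ℝ) - i| = j.factorial * (N - j).factorial := by
  obtain ⟨m, rfl⟩ := Nat.exists_eq_add_of_le hj
  have h1 : ∏ i ∈ (Finset.range (j + m + 1)).erase j, |(j : ℝ) - i| =
      ∏ i ∈ Finset.range (j + 1 + m), if i = j then (1 : ℝ) else |(j : ℝ) - i| := by
    rw [show j + m + 1 = j + 1 + m by ring]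
    rw [← Finset.mul_prod_erase (Finset.range (j + 1 + m)) _ (a := j) (by simp; omega)]
    simp only [if_true, one_mul]
    refine Finset.prod_congr rfl fun i hi => ?_
    rw [if_neg (Finset.ne_of_mem_erase hi)]
  rw [h1, Finset.prod_range_add, Finset.prod_range_succ, if_pos rfl, mul_one]
  congr 1
  · rw [← Finset.prod_range_reflect, ← Finset.prod_range_add_one_eq_factorial]
    push_cast
    refine Finset.prod_congr rfl fun i hi => ?_
    have hi' := Finset.mem_range.1 hi
    rw [if_neg (by omega), Nat.sub_sub, Nat.cast_sub (by omega)]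
    push_cast
    rw [abs_of_nonneg] <;> ring_nf
    positivity
  · rw [Nat.add_sub_cancel_left, ← Finset.prod_range_add_one_eq_factorial]
    push_cast
    refine Finset.prod_congr rfl fun i hi => ?_
    rw [if_neg (by omega), abs_sub_comm, abs_of_nonneg] <;> ring_nf
    positivity

/-- A polynomial of degree less than `n` which is at most `ε` on an interval grows by at most the
factor `(2 e D / ℓ) ^ n` outside of it, where `ℓ` is the length of the interval and `D` bounds the
distance to its points. This is a crude form of Remez' inequality, proved by Lagrange interpolation
at equally spaced nodes. -/
lemma norm_eval_le_of_norm_le_on_interval (P : Polynomial ℂ) (n : ℕ) (hP : P.degree < n)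
    (a ℓ D ε x : ℝ) (hℓ : 0 < ℓ) (hD : ℓ ≤ 2 * D) (hε : 0 ≤ ε)
    (hPε : ∀ y ∈ Set.Icc a (a + ℓ), ‖P.eval (y : ℂ)‖ ≤ ε)
    (hx : ∀ y ∈ Set.Icc a (a + ℓ), |x - y| ≤ D) :
    ‖P.eval (x : ℂ)‖ ≤ (2 * Real.exp 1 * D / ℓ) ^ n * ε := by
  rcases n with _ | N
  · have : P = 0 := by simpa using hP
    simpa [this] using hε
  set d : ℝ := ℓ / (N + 1) with hd
  have hd0 : 0 < d := by positivity
  set v : ℕ → ℂ := fun i => ((a + d * i : ℝ) : ℂ) with hv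
  have hmem : ∀ i ∈ Finset.range (N + 1), a + d * i ∈ Set.Icc a (a + ℓ) := by
    intro i hi
    have hi' : (i : ℝ) ≤ N + 1 := by
      exact_mod_cast (Finset.mem_range.1 hi).le
    refine ⟨by simpa using by positivity, ?_⟩
    have : d * i ≤ d * (N + 1) := by gcongr
    have : d * (N + 1) = ℓ := by rw [hd]; field_simp
    linarith
  have hinj : Set.InjOn v (Finset.range (N + 1)) := by
    intro i _ j _ hij
    simp only [hv, Complex.ofReal_inj, add_right_inj] at hij
    exact_mod_cast mul_left_cancel₀ hd0.ne' hij
  have hint := Lagrange.eq_interpolate (f := P) hinj (by simpa using hP)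
  have hD0 : 0 ≤ D := by linarith
  have hterm : ∀ j ∈ Finset.range (N + 1),
      ‖P.eval (v j) / (∏ i ∈ (Finset.range (N + 1)).erase j, (v j - v i)) *
        ∏ i ∈ (Finset.range (N + 1)).erase j, ((x : ℂ) - v i)‖ ≤
        ε * (D / d) ^ N / N.factorial * N.choose j := by
    intro j hj
    have hjN : j ≤ N := Nat.lt_succ_iff.1 (Finset.mem_range.1 hj)
    have hcard : ((Finset.range (N + 1)).erase j).card = N := by
      rw [Finset.card_erase_of_mem hj, Finset.card_range]; rfl
    have e1 : ‖∏ i ∈ (Finset.range (N + 1)).erase j, (v j - v i)‖ =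
        d ^ N * (j.factorial * (N - j).factorial) := by
      rw [← prod_erase_range_abs_sub N j hjN, norm_prod]
      have hc : d ^ N = ∏ i ∈ (Finset.range (N + 1)).erase j, d := by
        rw [Finset.prod_const, hcard]
      rw [hc, ← Finset.prod_mul_distrib]
      refine Finset.prod_congr rfl fun i _ => ?_
      rw [hv, ← Complex.ofReal_sub, Complex.norm_real, Real.norm_eq_abs,
        show a + d * (j : ℝ) - (a + d * i) = d * (j - i) by ring, abs_mul, abs_of_pos hd0]
    have e2 : ‖∏ i ∈ (Finset.range (N + 1)).erase j, ((x : ℂ) - v i)‖ ≤ D ^ N := by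
      rw [norm_prod]
      conv_rhs => rw [← hcard, ← Finset.prod_const]
      refine Finset.prod_le_prod (fun _ _ => norm_nonneg _) fun i hi => ?_
      rw [hv, ← Complex.ofReal_sub, Complex.norm_real, Real.norm_eq_abs]
      exact hx _ (hmem i (Finset.mem_of_mem_erase hi))
    have e3 : ‖P.eval (v j)‖ ≤ ε := hPε _ (hmem j hj)
    rw [norm_mul, norm_div, e1, Nat.cast_choose ℝ hjN]
    calc _ ≤ ε / (d ^ N * (j.factorial * (N - j).factorial)) * D ^ N := by gcongr
      _ = _ := by
        have := Nat.factorial_ne_zero N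
        rw [div_pow D d]
        clear_value d
        field_simp
  have hle : ‖P.eval (x : ℂ)‖ ≤ ε * (D / d) ^ N / N.factorial * 2 ^ N := by
    rw [hint, Lagrange.interpolate_eq_sum, Polynomial.eval_finsetSum]
    simp only [Polynomial.eval_mul, Polynomial.eval_C, Polynomial.eval_prod, Polynomial.eval_sub,
      Polynomial.eval_X]
    refine (norm_sum_le _ _).trans ((Finset.sum_le_sum hterm).trans_eq ?_)
    rw [← Finset.mul_sum, ← Nat.cast_sum, Nat.sum_range_choose]
    push_cast; ring
  refine hle.trans ?_
  have hfac : ((N : ℝ) + 1) ^ N / N.factorial ≤ Real.exp 1 ^ (N + 1) := by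
    rw [← Real.exp_nat_mul]
    simpa using Real.pow_div_factorial_le_exp (x := (N : ℝ) + 1) (by positivity) N
  have hone : 1 ≤ 2 * D / ℓ := by rw [le_div_iff₀ hℓ]; linarith
  calc ε * (D / d) ^ N / N.factorial * 2 ^ N
      = (2 * D / ℓ) ^ N * (((N : ℝ) + 1) ^ N / N.factorial) * ε := by
        rw [hd, show D / (ℓ / ((N : ℝ) + 1)) = D / ℓ * (N + 1) by field_simp,
          show 2 * D / ℓ = 2 * (D / ℓ) by ring, mul_pow, mul_pow]
        ring
    _ ≤ (2 * D / ℓ) ^ (N + 1) * Real.exp 1 ^ (N + 1) * ε := by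
        gcongr
        omega
    _ = _ := by rw [← mul_pow]; ring

/-- `F` is approximated by polynomials as well as a function of exponential type `s` is by its
Taylor polynomials: at every centre `c` and for every `n`, a polynomial of degree less than `n`
has the error `M (s |h|) ^ n / n!` at `c + h`, as soon as `2 s |h| ≤ n + 1`. -/
def HasTaylorApprox (F : ℝ → ℂ) (s : ℕ) (M : ℝ) : Prop :=
  ∀ (c : ℝ) (n : ℕ), ∃ P : Polynomial ℂ, P.degree < n ∧
    ∀ h : ℝ, s * |h| / (n + 1) ≤ 1 / 2 →
      ‖F (c + h) - P.eval (h : ℂ)‖ ≤ M * ((s * |h|) ^ n / n.factorial)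

/-- Smallness on an interval of radius `δ m` around `m` propagates to `[-m, m]`. -/
lemma HasTaylorApprox.norm_le {F : ℝ → ℂ} {s : ℕ} {M : ℝ} (hF : HasTaylorApprox F s M)
    (hs : 1 ≤ s) (hM : 0 ≤ M) (m : ℕ) (hm : 1 ≤ m) (δ ε : ℝ) (hδ : 0 < δ) (hδ1 : δ ≤ 1)
    (hε : 0 ≤ ε) (hFε : ∀ t : ℝ, |t - m| ≤ δ * m → ‖F t‖ ≤ ε) (x : ℝ) (hx : |x| ≤ m) :
    ‖F x‖ ≤ (10 / δ) ^ (60 * s * m) * ε + 2 * M * (1 / 2) ^ m := by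
  set n := 60 * s * m with hn
  have hs' : (1 : ℝ) ≤ s := by exact_mod_cast hs
  have hm' : (1 : ℝ) ≤ m := by exact_mod_cast hm
  have hnR : (n : ℝ) = 60 * s * m := by rw [hn]; push_cast; ring
  have he : Real.exp 1 ≤ 3 := Real.exp_one_lt_three.le
  obtain ⟨P, hPdeg, hP⟩ := hF m n
  -- the order `n` is admissible for all increments `h` with `|h| ≤ 2 m`
  have hadm : ∀ h : ℝ, |h| ≤ 2 * m → s * |h| / (n + 1) ≤ 1 / 2 := by
    intro h hh
    rw [div_le_iff₀ (by positivity), hnR]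
    have : s * |h| ≤ s * (2 * m) := by gcongr
    nlinarith
  have hxm := abs_le.1 hx
  have hxh : |x - m| ≤ 2 * m := abs_le.2 ⟨by linarith, by linarith⟩
  have h1 := hP (x - m) (hadm _ hxh)
  rw [add_sub_cancel] at h1
  set η : ℝ := ε + M * ((s * (δ * m)) ^ n / n.factorial) with hη
  have hPη : ∀ y ∈ Set.Icc (-(δ * m)) (-(δ * m) + 2 * (δ * m)), ‖P.eval (y : ℂ)‖ ≤ η := by
    intro y hy
    have hy' : |y| ≤ δ * m := abs_le.2 ⟨hy.1, by linarith [hy.2]⟩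
    have h2 := hP y (hadm y (hy'.trans (by nlinarith)))
    have h3 := hFε (m + y) (by simpa using hy')
    calc ‖P.eval (y : ℂ)‖ = ‖F (m + y) - (F (m + y) - P.eval (y : ℂ))‖ := by rw [sub_sub_cancel]
      _ ≤ ‖F (m + y)‖ + ‖F (m + y) - P.eval (y : ℂ)‖ := norm_sub_le _ _
      _ ≤ ε + M * ((s * |y|) ^ n / n.factorial) := add_le_add h3 h2
      _ ≤ η := by rw [hη]; gcongr
  have hgrow := norm_eval_le_of_norm_le_on_interval P n hPdeg (-(δ * m)) (2 * (δ * m)) (3 * m) η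
    (x - m) (by positivity) (by nlinarith) (by positivity) hPη (by
      intro y hy
      have h4 := abs_le.1 hxh
      have : δ * m ≤ m := by nlinarith
      exact abs_le.2 ⟨by linarith [hy.2], by linarith [hy.1]⟩)
  have hbase : 2 * Real.exp 1 * (3 * m) / (2 * (δ * m)) ≤ 10 / δ := by
    rw [div_le_div_iff₀ (by positivity) hδ]
    nlinarith [mul_pos hδ (show (0 : ℝ) < m by linarith)]
  -- since `n = 6 * (10 s m)`, Stirling's bound `n ^ n / n! ≤ e ^ n` makes the errors decay
  have hfac : (10 * s * m : ℝ) ^ n / n.factorial ≤ (1 / 2) ^ m := by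
    have h5 : (n : ℝ) ^ n / n.factorial ≤ Real.exp 1 ^ n := by
      rw [← Real.exp_nat_mul]
      simpa using Real.pow_div_factorial_le_exp (x := (n : ℝ)) (by positivity) n
    have h6 : (10 * s * m : ℝ) = n * (1 / 6) := by rw [hnR]; ring
    calc (10 * s * m : ℝ) ^ n / n.factorial = (n : ℝ) ^ n / n.factorial * (1 / 6) ^ n := by
          rw [h6, mul_pow]; ring
      _ ≤ 3 ^ n * (1 / 6) ^ n := by
          gcongr
          exact h5.trans (by gcongr)
      _ = (1 / 2) ^ n := by rw [← mul_pow]; norm_num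
      _ ≤ (1 / 2) ^ m := pow_le_pow_of_le_one (by norm_num) (by norm_num) (by nlinarith)
  have hA : (10 / δ) ^ n * (M * ((s * (δ * m)) ^ n / n.factorial)) ≤ M * (1 / 2) ^ m := by
    calc (10 / δ) ^ n * (M * ((s * (δ * m)) ^ n / n.factorial))
        = M * ((10 / δ * (s * (δ * m))) ^ n / n.factorial) := by rw [mul_pow (10 / δ)]; ring
      _ = M * ((10 * s * m : ℝ) ^ n / n.factorial) := by
          congr 3; field_simp
      _ ≤ _ := by gcongr
  have hB : M * ((s * |x - m|) ^ n / n.factorial) ≤ M * (1 / 2) ^ m := by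
    refine le_trans ?_ (mul_le_mul_of_nonneg_left hfac hM)
    have : s * |x - m| ≤ 10 * s * m := by
      calc s * |x - m| ≤ s * (2 * m) := by gcongr
        _ ≤ _ := by nlinarith
    gcongr
  calc ‖F x‖ = ‖F x - P.eval ((x - m : ℝ) : ℂ) + P.eval ((x - m : ℝ) : ℂ)‖ := by
        rw [sub_add_cancel]
    _ ≤ ‖F x - P.eval ((x - m : ℝ) : ℂ)‖ + ‖P.eval ((x - m : ℝ) : ℂ)‖ := norm_add_le _ _
    _ ≤ M * (1 / 2) ^ m + (10 / δ) ^ n * η := by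
        refine add_le_add (h1.trans hB) (hgrow.trans ?_)
        gcongr
    _ ≤ _ := by rw [hη, mul_add]; linarith

/-- The radii `m k / 2 ^ (k + 2)` lose a factor `2 ^ O(k m)` in the propagation of smallness, which
the bound `exp (-k ^ 2 m)` outweighs. -/
lemma HasTaylorApprox.eq_zero {F : ℝ → ℂ} {s : ℕ} {M : ℝ} (hF : HasTaylorApprox F s M)
    (hs : 1 ≤ s) (hM : 0 ≤ M) (m : ℕ → ℕ) (hm : ∀ k, k + 1 ≤ m k)
    (hsmall : ∀ (k : ℕ) (t : ℝ), |t - m k| ≤ m k / 2 ^ (k + 2) →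
      ‖F t‖ ≤ Real.exp (-((k : ℝ) ^ 2 * m k))) (x : ℝ) : F x = 0 := by
  obtain ⟨K, hK⟩ := exists_nat_ge (max |x| (620 * s))
  have hbound : ∀ k ≥ K, ‖F x‖ ≤ Real.exp (-1) ^ k + 2 * M * (1 / 2) ^ k := by
    intro k hk
    have hkR : (K : ℝ) ≤ k := by exact_mod_cast hk
    have hmk : (k : ℝ) ≤ m k := by exact_mod_cast (Nat.le_succ k).trans (hm k)
    have hx : |x| ≤ m k := by linarith [le_max_left |x| (620 * s : ℝ)]
    have hsk : (620 * s : ℝ) ≤ k := by linarith [le_max_right |x| (620 * s : ℝ)]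
    have hs' : (1 : ℝ) ≤ s := by exact_mod_cast hs
    have h := hF.norm_le hs hM (m k) (by linarith [hm k]) ((2 ^ (k + 2))⁻¹)
      (Real.exp (-((k : ℝ) ^ 2 * m k))) (by positivity)
      (inv_le_one_of_one_le₀ (one_le_pow₀ (by norm_num))) (by positivity)
      (fun t ht => hsmall k t (by rwa [div_eq_inv_mul])) x hx
    refine h.trans (add_le_add ?_ ?_)
    · have h10 : 10 / (2 ^ (k + 2))⁻¹ ≤ Real.exp ((k : ℝ) + 6) := by
        have h2 : (2 : ℝ) ≤ Real.exp 1 := by linarith [Real.add_one_le_exp 1]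
        calc 10 / ((2 : ℝ) ^ (k + 2))⁻¹ = 10 * 2 ^ (k + 2) := by rw [div_inv_eq_mul]
          _ ≤ 2 ^ (k + 6) := by rw [pow_add, pow_add]; nlinarith [pow_pos (two_pos (α := ℝ)) k]
          _ ≤ Real.exp 1 ^ (k + 6) := by gcongr
          _ = Real.exp ((k : ℝ) + 6) := by rw [← Real.exp_nat_mul]; push_cast; ring_nf
      calc (10 / (2 ^ (k + 2))⁻¹) ^ (60 * s * m k) * Real.exp (-((k : ℝ) ^ 2 * m k))
          ≤ Real.exp ((k : ℝ) + 6) ^ (60 * s * m k) * Real.exp (-((k : ℝ) ^ 2 * m k)) := by gcongr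
        _ = Real.exp (m k * (60 * s * (k + 6) - (k : ℝ) ^ 2)) := by
            rw [← Real.exp_nat_mul, ← Real.exp_add]; push_cast; ring_nf
        _ ≤ Real.exp (k * -1) := by
            refine Real.exp_le_exp.2 ?_
            have : 60 * s * (k + 6) - (k : ℝ) ^ 2 ≤ -1 := by nlinarith
            nlinarith
        _ = _ := by rw [Real.exp_nat_mul]
    · gcongr 2 * M * ?_
      exact pow_le_pow_of_le_one (by norm_num) (by norm_num) ((Nat.le_succ k).trans (hm k))
  have hlim : Filter.Tendsto (fun k : ℕ => Real.exp (-1) ^ k + 2 * M * (1 / 2 : ℝ) ^ k)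
      Filter.atTop (nhds (0 + 2 * M * 0)) :=
    (tendsto_pow_atTop_nhds_zero_of_lt_one (by positivity) (by simp)).add
      ((tendsto_pow_atTop_nhds_zero_of_lt_one (by norm_num) (by norm_num)).const_mul _)
  have := ge_of_tendsto hlim (Filter.eventually_atTop.2 ⟨K, hbound⟩)
  simpa using this

/-! ### Construction of the weight -/

/-- A smooth plateau function: `1` on `[-1, 1]`, `0` outside of `(-2, 2)`, with bounded
derivative. -/
lemma exists_plateau : ∃ (ψ : ℝ → ℝ) (B : ℝ), ContDiff ℝ 1 ψ ∧ (∀ x, 0 ≤ ψ x) ∧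
    (∀ x, ψ x ≤ 1) ∧ (∀ x, |x| ≤ 1 → ψ x = 1) ∧ (∀ x, 2 ≤ |x| → ψ x = 0) ∧
    ∀ x, |deriv ψ x| ≤ B := by
  let ψ : ContDiffBump (0 : ℝ) := ⟨1, 2, one_pos, one_lt_two⟩
  have hψ : ContDiff ℝ 1 ψ := ψ.contDiff
  obtain ⟨B, hB⟩ := (hψ.continuous_deriv le_rfl).bounded_above_of_compact_support
    ψ.hasCompactSupport.deriv
  refine ⟨ψ, B, hψ, fun x => ψ.nonneg, fun x => ψ.le_one,
    fun x hx => ψ.one_of_mem_closedBall ?_, fun x hx => ψ.zero_of_le_dist ?_,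
    hB⟩
  · simpa using hx
  · simpa using hx

lemma integrable_tsum_of_lintegral_le {b : ℕ → ℝ → ℝ} {c : ℕ → ℝ} (hmeas : ∀ k, Measurable (b k))
    (hb : ∀ k t, 0 ≤ b k t) (hsum : ∀ t, Summable fun k => b k t) (hc : ∀ k, 0 ≤ c k)
    (hcs : Summable c) (h : ∀ k, ∫⁻ t, ENNReal.ofReal (b k t) ≤ ENNReal.ofReal (c k)) :
    Integrable fun t : ℝ => ∑' k, b k t := by
  refine ⟨?_, ?_⟩
  · exact (measurable_of_tendsto_metrizable
      (fun K => Finset.measurable_fun_sum (Finset.range K) fun k _ => hmeas k)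
      (tendsto_pi_nhds.2 fun t => (hsum t).hasSum.tendsto_sum_nat)).aestronglyMeasurable
  · rw [hasFiniteIntegral_iff_ofReal (Filter.Eventually.of_forall fun t => tsum_nonneg (hb · t)),
      lintegral_congr fun t => ENNReal.ofReal_tsum_of_nonneg (hb · t) (hsum t),
      lintegral_tsum fun k => (hmeas k).ennreal_ofReal.aemeasurable]
    refine lt_of_le_of_lt (ENNReal.tsum_le_tsum h) ?_
    rw [← ENNReal.ofReal_tsum_of_nonneg hc hcs]
    exact ENNReal.ofReal_lt_top

/-- The bump of height `k ^ 2 m`, centred at `m`, of width proportional to `m / 2 ^ k`. -/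
def scaledBump (ψ : ℝ → ℝ) (k m : ℕ) (t : ℝ) : ℝ :=
  (k : ℝ) ^ 2 * m * ψ ((t - m) * (2 ^ (k + 2) / m))

section scaledBump

variable {ψ : ℝ → ℝ} {k m : ℕ}

lemma scaledBump_nonneg (h0 : ∀ x, 0 ≤ ψ x) (t : ℝ) : 0 ≤ scaledBump ψ k m t :=
  mul_nonneg (by positivity) (h0 _)

lemma contDiff_scaledBump (hψ : ContDiff ℝ 1 ψ) : ContDiff ℝ 1 (scaledBump ψ k m) := by
  unfold scaledBump
  fun_prop

lemma scaledBump_eq_zero (hm : 1 ≤ m) (hsupp : ∀ x, 2 ≤ |x| → ψ x = 0) {t : ℝ}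
    (ht : m / 2 ^ (k + 1) ≤ |t - m|) : scaledBump ψ k m t = 0 := by
  have hm' : (0 : ℝ) < m := by exact_mod_cast hm
  rw [scaledBump, hsupp, mul_zero]
  rw [abs_mul, abs_of_pos (a := (2 : ℝ) ^ (k + 2) / m) (by positivity)]
  calc (2 : ℝ) = m / 2 ^ (k + 1) * (2 ^ (k + 2) / m) := by field_simp; ring
    _ ≤ _ := by gcongr

lemma scaledBump_eq_zero_of_le (hm : 1 ≤ m) (hsupp : ∀ x, 2 ≤ |x| → ψ x = 0) {t : ℝ}
    (ht : t ≤ m / 2) : scaledBump ψ k m t = 0 := by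
  refine scaledBump_eq_zero hm hsupp ?_
  rw [abs_sub_comm]
  refine le_trans ?_ (le_abs_self _)
  have : (m : ℝ) / 2 ^ (k + 1) ≤ m / 2 ^ 1 := by
    gcongr
    · norm_num
    · omega
  linarith

lemma le_scaledBump (hm : 1 ≤ m) (hone : ∀ x, |x| ≤ 1 → ψ x = 1) {t : ℝ}
    (ht : |t - m| ≤ m / 2 ^ (k + 2)) : (k : ℝ) ^ 2 * m ≤ scaledBump ψ k m t := by
  have hm' : (0 : ℝ) < m := by exact_mod_cast hm
  rw [scaledBump, hone, mul_one]
  rw [abs_mul, abs_of_pos (a := (2 : ℝ) ^ (k + 2) / m) (by positivity)]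
  calc _ ≤ (m : ℝ) / 2 ^ (k + 2) * (2 ^ (k + 2) / m) := by gcongr
    _ = 1 := by field_simp

lemma abs_deriv_scaledBump_le (hm : 1 ≤ m) (hψ : ContDiff ℝ 1 ψ) {B : ℝ}
    (hB : ∀ x, |deriv ψ x| ≤ B) (t : ℝ) :
    |deriv (scaledBump ψ k m) t| ≤ (k : ℝ) ^ 2 * 2 ^ (k + 2) * B := by
  have hm' : (0 : ℝ) < m := by exact_mod_cast hm
  have h1 : HasDerivAt (scaledBump ψ k m)
      ((k : ℝ) ^ 2 * m * (deriv ψ ((t - m) * (2 ^ (k + 2) / m)) * (2 ^ (k + 2) / m))) t := by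
    have hd := (hψ.differentiable one_ne_zero ((t - m) * (2 ^ (k + 2) / m))).hasDerivAt
    have hl : HasDerivAt (fun t : ℝ => (t - m) * (2 ^ (k + 2) / m)) (2 ^ (k + 2) / m) t := by
      simpa using ((hasDerivAt_id t).sub_const (m : ℝ)).mul_const ((2 : ℝ) ^ (k + 2) / m)
    exact (hd.comp t hl).const_mul _
  rw [h1.deriv, show (k : ℝ) ^ 2 * m * (deriv ψ ((t - m) * (2 ^ (k + 2) / m)) * (2 ^ (k + 2) / m))
    = (k : ℝ) ^ 2 * 2 ^ (k + 2) * deriv ψ ((t - m) * (2 ^ (k + 2) / m)) by field_simp, abs_mul,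
    abs_of_nonneg (a := (k : ℝ) ^ 2 * 2 ^ (k + 2)) (by positivity)]
  gcongr
  exact hB _

lemma lintegral_scaledBump_div_le (hm : 1 ≤ m) (h1 : ∀ x, ψ x ≤ 1)
    (hsupp : ∀ x, 2 ≤ |x| → ψ x = 0) :
    ∫⁻ t, ENNReal.ofReal (scaledBump ψ k m t / (1 + t ^ 2)) ≤
      ENNReal.ofReal (4 * ((k : ℝ) ^ 2 * (1 / 2) ^ k)) := by
  have hm' : (0 : ℝ) < m := by exact_mod_cast hm
  have hpt : ∀ t, ENNReal.ofReal (scaledBump ψ k m t / (1 + t ^ 2)) ≤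
      (Set.Icc ((m : ℝ) - m / 2 ^ (k + 1)) (m + m / 2 ^ (k + 1))).indicator
        (fun _ => ENNReal.ofReal (4 * (k : ℝ) ^ 2 / m)) t := by
    intro t
    by_cases ht : t ∈ Set.Icc ((m : ℝ) - m / 2 ^ (k + 1)) (m + m / 2 ^ (k + 1))
    · rw [Set.indicator_of_mem ht]
      refine ENNReal.ofReal_le_ofReal ?_
      have h2 : (m : ℝ) / 2 ^ (k + 1) ≤ m / 2 ^ 1 := by
        gcongr
        · norm_num
        · omega
      have h3 : (m : ℝ) / 2 ≤ t := by linarith [ht.1]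
      have h4 : scaledBump ψ k m t ≤ (k : ℝ) ^ 2 * m :=
        mul_le_of_le_one_right (by positivity) (h1 _)
      calc _ ≤ (k : ℝ) ^ 2 * m / (m / 2) ^ 2 := by
            gcongr
            nlinarith
        _ = _ := by field_simp; norm_num
    · rw [Set.indicator_of_notMem ht, scaledBump_eq_zero hm hsupp]
      · simp
      · by_contra! h
        have := abs_le.1 h.le
        exact ht ⟨by linarith, by linarith⟩
  refine (lintegral_mono hpt).trans ?_
  rw [lintegral_indicator measurableSet_Icc, setLIntegral_const, Real.volume_Icc,
    ← ENNReal.ofReal_mul (by positivity)]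
  refine ENNReal.ofReal_le_ofReal (le_of_eq ?_)
  rw [one_div_pow, pow_succ]
  field_simp
  ring

lemma integrable_tsum_scaledBump_div (hψ : ContDiff ℝ 1 ψ) (h0 : ∀ x, 0 ≤ ψ x)
    (h1 : ∀ x, ψ x ≤ 1) (hsupp : ∀ x, 2 ≤ |x| → ψ x = 0) {m : ℕ → ℕ} (hm : ∀ k, 1 ≤ m k)
    (hsum : ∀ t, Summable fun k => scaledBump ψ k (m k) t) :
    Integrable fun t : ℝ => (∑' k, scaledBump ψ k (m k) t) / (1 + t ^ 2) := by
  simp_rw [← tsum_div_const]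
  have hc : Summable fun k : ℕ => 4 * ((k : ℝ) ^ 2 * (1 / 2 : ℝ) ^ k) :=
    Summable.mul_left 4 (summable_pow_mul_geometric_of_norm_lt_one 2
      (show ‖(1 / 2 : ℝ)‖ < 1 by norm_num))
  exact integrable_tsum_of_lintegral_le
    (fun k => (contDiff_scaledBump hψ).continuous.measurable.div (by fun_prop))
    (fun k t => div_nonneg (scaledBump_nonneg h0 t) (by positivity))
    (fun t => (hsum t).div_const _) (fun k => by positivity)
    hc (fun k => lintegral_scaledBump_div_le (hm k) h1 hsupp)

end scaledBump

/-- Sparse bumps of heights `k ^ 2 m k` and slopes of order `k ^ 2 2 ^ k` give a weight with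
derivative bounded by `H` and with convergent logarithmic integral, if the `m k` are chosen so far
out that `H` dominates `2 ^ (k + 1)` times the slope of the `k`-th bump on its support. The spare
factor makes the bound hold for the sum without any need for disjoint supports. -/
lemma exists_weight (H : ℝ → ℝ) (hpos : ∀ x, 0 < H x) (hmono : MonotoneOn H (Set.Ici 0))
    (hunb : ¬ BddAbove (H '' Set.Ici 0)) :
    ∃ (Ω : ℝ → ℝ) (m : ℕ → ℕ), (∀ t, 0 ≤ Ω t) ∧ ContDiff ℝ 1 Ω ∧ (∀ t, |deriv Ω t| ≤ H t) ∧
      Integrable (fun t : ℝ => Ω t / (1 + t ^ 2)) ∧ (∀ k, k + 1 ≤ m k) ∧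
      ∀ (k : ℕ) (t : ℝ), |t - m k| ≤ m k / 2 ^ (k + 2) → (k : ℝ) ^ 2 * m k ≤ Ω t := by
  obtain ⟨ψ, B, hψ, h0, h1, hone, hsupp, hB⟩ := exists_plateau
  have hfar : ∀ k : ℕ, ∃ p : ℕ, k + 1 ≤ p ∧
      ∀ t : ℝ, p ≤ t → (k : ℝ) ^ 2 * 2 ^ (k + 2) * B * 2 ^ (k + 1) ≤ H t := by
    intro k
    have hx := hunb
    rw [not_bddAbove_iff] at hx
    obtain ⟨_, ⟨x, hx0, rfl⟩, hxK⟩ := hx ((k : ℝ) ^ 2 * 2 ^ (k + 2) * B * 2 ^ (k + 1))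
    obtain ⟨p, hp⟩ := exists_nat_ge x
    refine ⟨max p (k + 1), le_max_right _ _, fun t ht => hxK.le.trans ?_⟩
    have : x ≤ t := hp.trans (le_trans (by exact_mod_cast le_max_left _ _) ht)
    exact hmono hx0 (le_trans hx0 this) this
  choose p hpk hpH using hfar
  let m : ℕ → ℕ := fun k => 2 * p k
  have hm : ∀ k, k + 1 ≤ m k := fun k => by have := hpk k; simp only [m]; omega
  have hm1 : ∀ k, 1 ≤ m k := fun k => by have := hm k; omega
  have hm2 : ∀ k, (m k : ℝ) / 2 = p k := fun k => by simp [m]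
  let b : ℕ → ℝ → ℝ := fun k => scaledBump ψ k (m k)
  have hbz : ∀ (k : ℕ) (t : ℝ), t ≤ p k → b k t = 0 := fun k t ht =>
    scaledBump_eq_zero_of_le (hm1 k) hsupp (by rwa [hm2])
  have hbz' : ∀ (K : ℕ) (t : ℝ), t < K → ∀ k ∉ Finset.range K, b k t = 0 := by
    intro K t ht k hk
    refine hbz k t (ht.le.trans ?_)
    have : K ≤ p k := by
      have := hpk k
      simp only [Finset.mem_range, not_lt] at hk
      omega
    exact_mod_cast this
  let Ω : ℝ → ℝ := fun t => ∑' k, b k t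
  have hΩK : ∀ (K : ℕ) (t : ℝ), t < K → Ω t = ∑ k ∈ Finset.range K, b k t := fun K t ht =>
    tsum_eq_sum (hbz' K t ht)
  have hloc : ∀ t : ℝ, ∃ K : ℕ, Ω =ᶠ[nhds t] fun x => ∑ k ∈ Finset.range K, b k x := by
    intro t
    obtain ⟨K, hK⟩ := exists_nat_gt t
    exact ⟨K, Filter.eventually_of_mem (Iio_mem_nhds hK) fun x hx => hΩK K x hx⟩
  have hb0 : ∀ k t, 0 ≤ b k t := fun k t => scaledBump_nonneg h0 t
  have hbC : ∀ k, ContDiff ℝ 1 (b k) := fun k => contDiff_scaledBump hψ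
  have hbsum : ∀ t, Summable fun k => b k t := fun t => by
    obtain ⟨K, hK⟩ := exists_nat_gt t
    exact summable_of_ne_finset_zero (hbz' K t hK)
  have hΩ0 : ∀ t, 0 ≤ Ω t := fun t => tsum_nonneg fun k => hb0 k t
  have hΩC : ContDiff ℝ 1 Ω := by
    refine contDiff_iff_contDiffAt.2 fun t => ?_
    obtain ⟨K, hK⟩ := hloc t
    exact (ContDiff.sum fun k _ => hbC k).contDiffAt.congr_of_eventuallyEq hK
  refine ⟨Ω, m, hΩ0, hΩC, fun t => ?_,
    integrable_tsum_scaledBump_div hψ h0 h1 hsupp hm1 hbsum, hm, fun k t ht => ?_⟩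
  · obtain ⟨K, hK⟩ := hloc t
    have hbd : ∀ k, |deriv (b k) t| ≤ H t * (1 / 2) ^ (k + 1) := by
      intro k
      rcases lt_or_ge t (p k) with ht | ht
      · have : b k =ᶠ[nhds t] fun _ => 0 :=
          Filter.eventually_of_mem (Iio_mem_nhds ht) fun x hx => hbz k x (le_of_lt hx)
        rw [this.deriv_eq, deriv_const, abs_zero]
        exact mul_nonneg (hpos t).le (by positivity)
      · refine (abs_deriv_scaledBump_le (hm1 k) hψ hB t).trans ?_
        rw [one_div_pow, mul_one_div, le_div_iff₀ (by positivity)]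
        exact hpH k t ht
    rw [hK.deriv_eq, deriv_fun_sum fun k _ => (hbC k).differentiable one_ne_zero t]
    calc |∑ k ∈ Finset.range K, deriv (b k) t| ≤ ∑ k ∈ Finset.range K, |deriv (b k) t| :=
          Finset.abs_sum_le_sum_abs _ _
      _ ≤ ∑ k ∈ Finset.range K, H t * (1 / 2) ^ (k + 1) := Finset.sum_le_sum fun k _ => hbd k
      _ = H t * (1 / 2 * ∑ k ∈ Finset.range K, (1 / 2 : ℝ) ^ k) := by
          rw [← Finset.mul_sum, Finset.mul_sum _ _ (1 / 2 : ℝ)]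
          simp only [pow_succ']
      _ ≤ H t * 1 := by
          refine mul_le_mul_of_nonneg_left ?_ (hpos t).le
          linarith [sum_geometric_two_le K]
      _ = H t := mul_one _
  · exact (le_scaledBump (hm1 k) hone ht).trans ((hbsum t).le_tsum k fun j _ => hb0 j t)

/-! ### Functions of bounded spectrum -/

/-- The inverse Fourier integral of an integrable function supported in `[-ρ, ρ]` is approximated
by its Taylor polynomials. -/
lemma hasTaylorApprox_fourierInv {g : ℝ → ℂ} (hg : Integrable g) {ρ : ℝ} {s : ℕ}
    (hsupp : ∀ᵐ ξ : ℝ, ρ < |ξ| → g ξ = 0) (hs : 2 * Real.pi * ρ ≤ s) :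
    HasTaylorApprox (𝓕⁻ g) s (2 * ∫ ξ, ‖g ξ‖) := by
  intro c n
  -- the Fourier kernel, and the integrands of the Taylor coefficients
  let e : ℝ → ℝ → ℂ := fun t ξ => Complex.exp ((2 * Real.pi * ξ * t : ℝ) * Complex.I)
  let u : ℝ → ℂ := fun ξ => (2 * Real.pi * ξ : ℝ) * Complex.I
  let a : ℕ → ℝ → ℂ := fun k ξ => e c ξ * u ξ ^ k / k.factorial * g ξ
  have he : ∀ t ξ, ‖e t ξ‖ = 1 := fun t ξ => Complex.norm_exp_ofReal_mul_I _
  have hu : ∀ ξ, ‖u ξ‖ = 2 * Real.pi * |ξ| := by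
    intro ξ
    simp [u, abs_of_pos Real.pi_pos]
  have heC : ∀ t, Continuous (e t) := fun t => by fun_prop
  have huC : Continuous u := by fun_prop
  have hF : ∀ t, 𝓕⁻ g t = ∫ ξ, e t ξ * g ξ := by
    intro t
    rw [Real.fourierInv_eq']
    refine integral_congr_ae (Filter.Eventually.of_forall fun ξ => ?_)
    simp only [e, smul_eq_mul, RCLike.inner_apply, conj_trivial]
    ring_nf
  have hei : ∀ t, Integrable fun ξ => e t ξ * g ξ := fun t =>
    hg.bdd_mul (c := 1) (heC t).aestronglyMeasurable
      (Filter.Eventually.of_forall fun ξ => (he t ξ).le)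
  have ha : ∀ k, Integrable (a k) := by
    intro k
    refine (hg.norm.const_mul ((s : ℝ) ^ k)).mono' ?_ ?_
    · exact (Continuous.aestronglyMeasurable (by fun_prop)).mul hg.aestronglyMeasurable
    · filter_upwards [hsupp] with ξ hξ
      rcases lt_or_ge ρ |ξ| with h | h
      · simp [a, hξ h]
      · have h1 : ‖u ξ‖ ≤ s := by
          rw [hu]
          exact le_trans (by gcongr) hs
        rw [norm_mul, norm_div, norm_mul, he, one_mul, norm_pow, Complex.norm_natCast]
        gcongr
        calc ‖u ξ‖ ^ k / k.factorial ≤ ‖u ξ‖ ^ k := div_le_self (by positivity)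
              (by exact_mod_cast Nat.one_le_iff_ne_zero.2 k.factorial_ne_zero)
          _ ≤ _ := by gcongr
  refine ⟨∑ k ∈ Finset.range n, Polynomial.monomial k (∫ ξ, a k ξ), ?_, fun h hh => ?_⟩
  · refine (Polynomial.degree_sum_le _ _).trans_lt ?_
    refine (Finset.sup_lt_iff (WithBot.bot_lt_coe n)).2 fun k hk => ?_
    exact (Polynomial.degree_monomial_le _ _).trans_lt
      (WithBot.coe_lt_coe.2 (Finset.mem_range.1 hk))
  · have hP : (∑ k ∈ Finset.range n, Polynomial.monomial k (∫ ξ, a k ξ)).eval (h : ℂ) =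
        ∫ ξ, ∑ k ∈ Finset.range n, a k ξ * (h : ℂ) ^ k := by
      rw [Polynomial.eval_finsetSum, integral_finsetSum _ fun k _ => (ha k).mul_const _]
      simp [integral_mul_const]
    rw [hP, hF, ← integral_sub (hei _) (integrable_finsetSum _ fun k _ => (ha k).mul_const _)]
    have hbound : ∀ᵐ ξ : ℝ, ‖e (c + h) ξ * g ξ - ∑ k ∈ Finset.range n, a k ξ * (h : ℂ) ^ k‖ ≤
        2 * ((s * |h|) ^ n / n.factorial) * ‖g ξ‖ := by
      filter_upwards [hsupp] with ξ hξ
      rcases lt_or_ge ρ |ξ| with h1 | h1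
      · simp [a, hξ h1]
      · have h2 : ‖u ξ * h‖ ≤ s * |h| := by
          rw [norm_mul, hu, Complex.norm_real, Real.norm_eq_abs]
          gcongr
          exact le_trans (by gcongr) hs
        have h3 := Complex.exp_bound' (x := u ξ * h) (n := n) (by
          refine le_trans ?_ hh
          rw [Nat.cast_succ]
          gcongr)
        have h4 : e (c + h) ξ * g ξ - ∑ k ∈ Finset.range n, a k ξ * (h : ℂ) ^ k =
            e c ξ * (Complex.exp (u ξ * h) -
              ∑ k ∈ Finset.range n, (u ξ * h) ^ k / k.factorial) * g ξ := by
          have h5 : e (c + h) ξ = e c ξ * Complex.exp (u ξ * h) := by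
            simp only [e, u]
            rw [← Complex.exp_add]
            push_cast
            ring_nf
          rw [h5, mul_sub, sub_mul, Finset.mul_sum, Finset.sum_mul]
          congr 1
          refine Finset.sum_congr rfl fun k _ => ?_
          simp only [a]
          ring
        rw [h4, norm_mul, norm_mul, he, one_mul]
        gcongr
        refine h3.trans ?_
        rw [mul_comm]
        gcongr
    refine (norm_integral_le_of_norm_le (hg.norm.const_mul _) hbound).trans_eq ?_
    rw [integral_const_mul]
    ring

/-- By the Lindelöf property, countably many of the open sets in the definition of `essSupport`
suffice, so the exceptional null sets do not add up. -/
lemma ae_eq_zero_of_notMem_essSupport (g : ℝ → ℂ) : ∀ᵐ x : ℝ, x ∉ essSupport g → g x = 0 := by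
  obtain ⟨T, hTc, hTS, hTU⟩ := TopologicalSpace.isOpen_sUnion_countable
    {O : Set ℝ | IsOpen O ∧ ∀ᵐ x ∂(volume.restrict O), g x = 0} fun O hO => hO.1
  have h : ∀ᵐ x : ℝ, ∀ O ∈ T, x ∈ O → g x = 0 := by
    rw [ae_ball_iff hTc]
    exact fun O hO => (ae_restrict_iff' (hTS hO).1.measurableSet).1 (hTS hO).2
  filter_upwards [h] with x hx hxs
  rw [essSupport, Set.notMem_compl_iff, ← hTU] at hxs
  obtain ⟨O, hO, hxO⟩ := hxs
  exact hx O hO hxO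

lemma exists_ae_fourier_eq_zero_of_isBounded_spec (f : Lp ℂ 2 (volume : Measure ℝ))
    (hf : Bornology.IsBounded (spec f)) :
    ∃ ρ : ℝ, 0 ≤ ρ ∧ ∀ᵐ ξ : ℝ, ρ < |ξ| → (𝓕 f : Lp ℂ 2 (volume : Measure ℝ)) ξ = 0 := by
  obtain ⟨R, hR0, hR⟩ := hf.exists_pos_norm_le
  have hpi : (0 : ℝ) < 2 * Real.pi := by positivity
  refine ⟨R / (2 * Real.pi), by positivity, ?_⟩
  have h1 : ∀ᵐ x : ℝ, R < |x| → planchFourier f x = 0 := by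
    filter_upwards [ae_eq_zero_of_notMem_essSupport (planchFourier f)] with x hx hRx
    exact hx fun hmem => absurd (hR x hmem) (not_le.2 hRx)
  have hq : Measure.QuasiMeasurePreserving (fun ξ : ℝ => 2 * Real.pi * ξ) volume volume := by
    refine ⟨by fun_prop, ?_⟩
    rw [Real.map_volume_mul_left hpi.ne']
    exact Measure.smul_absolutelyContinuous
  filter_upwards [hq.ae h1] with ξ hξ hlt
  have := hξ (by
    rw [div_lt_iff₀ hpi] at hlt
    rwa [abs_mul, abs_of_pos hpi, mul_comm])
  rwa [planchFourier, mul_div_cancel_left₀ _ hpi.ne'] at this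

lemma continuous_fourierInv_of_integrable {g : ℝ → ℂ} (hg : Integrable g) :
    Continuous (𝓕⁻ g) :=
  VectorFourier.fourierIntegral_continuous Real.continuous_fourierChar
    (by simpa using by fun_prop) hg

/-- If the Plancherel transform of an `L²`-function is integrable, the function is given by the
inverse Fourier integral. -/
lemma ae_eq_fourierInv_of_integrable (f : Lp ℂ 2 (volume : Measure ℝ))
    (hg : Integrable (𝓕 f : Lp ℂ 2 (volume : Measure ℝ))) :
    f =ᵐ[volume] 𝓕⁻ ((𝓕 f : Lp ℂ 2 (volume : Measure ℝ)) : ℝ → ℂ) := by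
  set g : Lp ℂ 2 (volume : Measure ℝ) := 𝓕 f with hgdef
  have hfg : 𝓕⁻ g = f := FourierTransform.fourierInv_fourier_eq f
  refine ae_eq_of_integral_contDiff_smul_eq
    ((Lp.memLp f).locallyIntegrable (by norm_num))
    (continuous_fourierInv_of_integrable hg).locallyIntegrable fun φ hφ hφc => ?_
  have hφC : HasCompactSupport fun x => (φ x : ℂ) :=
    hφc.comp_left (g := fun y : ℝ => (y : ℂ)) (by simp)
  let Φ : SchwartzMap ℝ ℂ := hφC.toSchwartzMap (Complex.ofRealCLM.contDiff.comp hφ)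
  have hΦ : ∀ x, Φ x = φ x := fun x => rfl
  have hleft : ∫ x, Φ x • f x = ∫ x, (𝓕⁻ Φ) x • g x := by
    rw [← Lp.toTemperedDistribution_apply f Φ, ← Lp.toTemperedDistribution_apply g (𝓕⁻ Φ),
      ← TemperedDistribution.fourierInv_apply, Lp.fourierInv_toTemperedDistribution_eq, hfg]
  have hright : ∫ x, (𝓕⁻ Φ) x • g x = ∫ x, Φ x • 𝓕⁻ (g : ℝ → ℂ) x := by
    have := VectorFourier.integral_fourierIntegral_smul_eq_flip (μ := volume) (ν := volume)
      (L := -innerₗ ℝ) (f := Φ) (g := (g : ℝ → ℂ)) Real.continuous_fourierChar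
      (by simpa using by fun_prop) Φ.integrable hg
    rw [SchwartzMap.fourierInv_coe]
    have hflip : (-innerₗ ℝ).flip = -innerₗ ℝ := by
      ext
      simp
    rw [hflip] at this
    exact this
  have := hleft.trans hright
  simpa [hΦ] using this
/-- An `L²`-function with bounded spectrum is almost everywhere equal to a continuous function which
is approximated by its Taylor polynomials like a function of exponential type. -/
lemma exists_hasTaylorApprox_ae_eq (f : Lp ℂ 2 (volume : Measure ℝ))
    (hf : Bornology.IsBounded (spec f)) :
    ∃ (s : ℕ) (M : ℝ) (F : ℝ → ℂ), 1 ≤ s ∧ 0 ≤ M ∧ HasTaylorApprox F s M ∧ Continuous F ∧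
      f =ᵐ[volume] F := by
  obtain ⟨ρ, hρ, hsupp⟩ := exists_ae_fourier_eq_zero_of_isBounded_spec f hf
  obtain ⟨s, hs⟩ := exists_nat_ge (2 * Real.pi * ρ)
  have hg : Integrable (𝓕 f : Lp ℂ 2 (volume : Measure ℝ)) := by
    refine IntegrableOn.integrable_of_ae_notMem_eq_zero (s := Set.Icc (-ρ) ρ) ?_ ?_
    · exact ((Lp.memLp _).restrict _).integrable (by norm_num)
    · filter_upwards [hsupp] with ξ hξ hmem
      exact hξ (not_le.1 fun h => hmem (abs_le.1 h))
  exact ⟨s + 1, _, _, by omega, by positivity,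
    hasTaylorApprox_fourierInv hg hsupp (hs.trans (by push_cast; linarith)),
    continuous_fourierInv_of_integrable hg, ae_eq_fourierInv_of_integrable f hg⟩

end

/-! ### Vanishing of the functions majorized by the weight -/

theorem theorem2 (H : ℝ → ℝ) (hpos : ∀ x, 0 < H x)
    (hmono : MonotoneOn H (Set.Ici 0)) (hunb : ¬ BddAbove (H '' Set.Ici 0)) :
    ∃ Ω : ℝ → ℝ, (∀ t, 0 ≤ Ω t) ∧ ContDiff ℝ 1 Ω ∧
      (∀ t, |deriv Ω t| ≤ H t) ∧
      Integrable (fun t : ℝ => Ω t / (1 + t ^ 2)) ∧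
      (∀ f : Lp ℂ 2 (volume : Measure ℝ), Bornology.IsBounded (spec f) →
        (∀ᵐ x : ℝ, ‖f x‖ ≤ Real.exp (-Ω x)) → ∀ᵐ x : ℝ, f x = 0) ∧
      ¬ IsBMMajorant (fun x => Real.exp (-Ω x)) := by
  obtain ⟨Ω, m, h0, hC, hd, hint, hm, hbig⟩ := exists_weight H hpos hmono hunb
  have hvanish : ∀ f : Lp ℂ 2 (volume : Measure ℝ), Bornology.IsBounded (spec f) →
      (∀ᵐ x : ℝ, ‖f x‖ ≤ Real.exp (-Ω x)) → ∀ᵐ x : ℝ, f x = 0 := by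
    intro f hf hle
    obtain ⟨s, M, F, hs, hM, hF, hFC, hfF⟩ := exists_hasTaylorApprox_ae_eq f hf
    -- by continuity the majorization of `F` holds everywhere
    have hFle : ∀ t, ‖F t‖ ≤ Real.exp (-Ω t) := by
      have hdense : Dense {t | ‖F t‖ ≤ Real.exp (-Ω t)} := Measure.dense_of_ae (μ := volume) (by
        filter_upwards [hle, hfF] with t ht hft
        rwa [← hft])
      have hclosed : IsClosed {t | ‖F t‖ ≤ Real.exp (-Ω t)} :=
        isClosed_le hFC.norm (Real.continuous_exp.comp hC.continuous.neg)
      exact fun t => hclosed.closure_subset (hdense t)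
    have hFz := hF.eq_zero hs hM m hm fun k t ht =>
      (hFle t).trans (Real.exp_le_exp.2 (neg_le_neg (hbig k t ht)))
    filter_upwards [hfF] with t ht
    rw [ht, hFz]
  refine ⟨Ω, h0, hC, hd, hint, hvanish, fun ⟨_, _, hBM⟩ => ?_⟩
  obtain ⟨f, hf0, hle, hspec⟩ := hBM 1 one_pos
  refine hf0 ((Lp.eq_zero_iff_ae_eq_zero).2 ?_)
  exact hvanish f ((Metric.isBounded_Icc _ _).subset hspec) hle
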